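/- **Theorem.** Let $d\ge 1$ and let $(\mathcal V,\mathcal E)$ be a Bratteli diagram whose vertices at level $n\ge 0$ are $(n,k)$, $0\le k\le dn$, and in which each vertex $(n,k)$ is joined to each vertex $(n+1,k+i)$, $i\in\{0,1,\dots,d\}$, by some positive finite number of edges (depending on $n,k,i$), there being no other edges. Order the edges with the same terminal vertex from left to right: by the index $k$ of their source $(n,k)$, and parallel edges by a fixed numbering. Let $X$ be the space of infinite edge paths $\gamma=\gamma_0\gamma_1\dots$ from the root $(0,0)$, with the metric $2^{-j}$, $j=\min\{i:\gamma_i\ne\xi_i\}$, and its Borel $\sigma$-algebra. For paths $\gamma\neq\xi$ that agree from some index on, put $\gamma<\xi$ iff $\gamma_n<\xi_n$ at the last index $n$ with $\gamma_n\ne\xi_n$. For $k\in\{0,1,\dots\}\cup\{\infty\}$ let $\gamma^k_{\max}$ be the path through the vertices $(n,\min(k,dn))$, $n\ge0$, all of whose edges are maximal, and let $\gamma^k_{\min}$ be the path through the vertices $(n,dn-\min(k,dn))$, all of whose edges are minimal; the $\gamma^k_{\max}$ are exactly the paths all of whose edges are maximal. Let $T:X\to X$ map each path other than the $\gamma^k_{\max}$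 to its successor, i.e. the least path greater than it, and put $T\gamma^k_{\max}=\gamma^k_{\min}$ for $0<k<\infty$, $T\gamma^0_{\max}=\gamma^\infty_{\min}$, $T\gamma^\infty_{\max}=\gamma^0_{\min}$. Then for every $T$-invariant Borel probability measure $\mu$ on $X$, the measure-theoretic (Kolmogorov–Sinai) entropy of $T$ vanishes: $h_\mu(T)=0$, where $h_\mu(T)=\sup_{\mathcal P}\lim_{n\to\infty}\frac1n H_\mu\bigl(\bigvee_{i=0}^{n-1}T^{-i}\mathcal P\bigr)$, the supremum being over all finite measurable partitions $\mathcal P$ of $X$ and $H_\mu(\mathcal Q)=-\sum_{A\in\mathcal Q}\mu(A)\log\mu(A)$. -/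

import Mathlib

open MeasureTheory

/-- A Bratteli diagram of limited scope: level `n` has the `d * n + 1` vertices `(n, k)`,
`0 ≤ k ≤ d * n`, and for `0 ≤ i ≤ d` there are `mult n k i ≥ 1` edges from `(n, k)` to
`(n + 1, k + i)`; there are no other edges. -/
structure LimitedScopeDiagram where
  d : ℕ
  d_pos : 0 < d
  mult : (n : ℕ) → Fin (d * n + 1) → Fin (d + 1) → ℕ
  mult_pos : ∀ n k i, 0 < mult n k i

namespace LimitedScopeDiagram

/-- The edges from level `n` to level `n + 1`: the edge number `idx` (counted from the left)
among the parallel edges from `(n, src)` to `(n + 1, src + shift)`. -/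
structure Edge (D : LimitedScopeDiagram) (n : ℕ) where
  src : Fin (D.d * n + 1)
  shift : Fin (D.d + 1)
  idx : Fin (D.mult n src shift)

namespace Edge

variable {D : LimitedScopeDiagram} {n : ℕ}

/-- The terminal vertex of an edge. -/
def rng (e : D.Edge n) : Fin (D.d * (n + 1) + 1) :=
  ⟨e.src + e.shift, by
    have h1 := e.src.isLt
    have h2 := e.shift.isLt
    rw [Nat.mul_add]
    omega⟩

/-- The edge ordering: only edges with the same terminal vertex are compared, and they increase
from left to right. -/
def Below (e f : D.Edge n) : Prop :=
  e.rng = f.rng ∧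
    ((e.src : ℕ) < (f.src : ℕ) ∨ ((e.src : ℕ) = (f.src : ℕ) ∧ (e.idx : ℕ) < (f.idx : ℕ)))

instance : Finite (D.Edge n) :=
  Finite.of_injective
    (fun e => (⟨e.src, e.shift, e.idx⟩ :
      (k : Fin (D.d * n + 1)) × (i : Fin (D.d + 1)) × Fin (D.mult n k i)))
    (by
      rintro ⟨a, b, c⟩ ⟨a', b', c'⟩ h
      obtain ⟨rfl, h⟩ := Sigma.mk.inj_iff.mp h
      obtain ⟨rfl, h⟩ := Sigma.mk.inj_iff.mp (eq_of_heq h)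
      obtain rfl : c = c' := eq_of_heq h
      rfl)

instance : TopologicalSpace (D.Edge n) := ⊥

instance : DiscreteTopology (D.Edge n) := ⟨rfl⟩

instance : MeasurableSpace (D.Edge n) := ⊤

instance : DiscreteMeasurableSpace (D.Edge n) := ⟨fun _ => trivial⟩

end Edge

/-- The space `X` of infinite edge paths starting at the root vertex `(0, 0)`, the only vertex of
level `0`. -/
def Path (D : LimitedScopeDiagram) : Type :=
  {γ : (n : ℕ) → D.Edge n // ∀ n, (γ n).rng = (γ (n + 1)).src}

variable {D : LimitedScopeDiagram}

/-- The topology of coordinatewise convergence, which is the one of the metric `2 ^ (-j)`, where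
`j` is the first index at which two paths differ. -/
instance : TopologicalSpace D.Path :=
  inferInstanceAs
    (TopologicalSpace {γ : (n : ℕ) → D.Edge n // ∀ n, (γ n).rng = (γ (n + 1)).src})

/-- The σ-algebra generated by the cylinder sets. -/
instance : MeasurableSpace D.Path :=
  inferInstanceAs
    (MeasurableSpace {γ : (n : ℕ) → D.Edge n // ∀ n, (γ n).rng = (γ (n + 1)).src})

/-- It is the Borel σ-algebra of the path space. -/
instance : BorelSpace D.Path :=
  inferInstanceAs
    (BorelSpace {γ : (n : ℕ) → D.Edge n // ∀ n, (γ n).rng = (γ (n + 1)).src})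

namespace Path

/-- The partial ordering of paths: `γ < ξ` iff they agree after some level and, at the last index
`n` at which they disagree, the edge of `γ` is below the edge of `ξ`. -/
def Below (γ ξ : D.Path) : Prop :=
  ∃ n, (γ.1 n).Below (ξ.1 n) ∧ ∀ m, n < m → γ.1 m = ξ.1 m

/-- `ξ` is the successor of `γ`: the least path above `γ`. -/
def IsSucc (γ ξ : D.Path) : Prop :=
  γ.Below ξ ∧ ∀ ζ : D.Path, γ.Below ζ → ξ = ζ ∨ ξ.Below ζ

end Path

/-- The integer `min k (d * n)`, with value `d * n` for `k = ∞`. -/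
noncomputable def cut (D : LimitedScopeDiagram) (k : ℕ∞) (n : ℕ) : ℕ :=
  if k = ⊤ then D.d * n else min k.toNat (D.d * n)

theorem cut_le (k : ℕ∞) (n : ℕ) : D.cut k n ≤ D.d * n := by
  unfold cut; split_ifs <;> omega

theorem cut_mono (k : ℕ∞) (n : ℕ) : D.cut k n ≤ D.cut k (n + 1) := by
  unfold cut; split_ifs <;> simp only [Nat.mul_add] <;> omega

theorem cut_succ_le (k : ℕ∞) (n : ℕ) : D.cut k (n + 1) ≤ D.cut k n + D.d := by
  unfold cut; split_ifs <;> simp only [Nat.mul_add] <;> omega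

/-- The path `γ_max^k`, `k ∈ {0, 1, …} ∪ {∞}`: it passes through the vertices `(n, min k (d * n))`
(that is, down the far right side as long as `d * n ≤ k`, and then through the vertices `(n, k)`),
and always takes the rightmost of the parallel edges. -/
noncomputable def maxPath (D : LimitedScopeDiagram) (k : ℕ∞) : D.Path :=
  ⟨fun n =>
    { src := ⟨D.cut k n, Nat.lt_succ_of_le (D.cut_le k n)⟩
      shift := ⟨D.cut k (n + 1) - D.cut k n, by have := D.cut_succ_le k n; omega⟩
      idx := ⟨D.mult n _ _ - 1, Nat.sub_lt (D.mult_pos _ _ _) Nat.one_pos⟩ },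
    fun n => by
      apply Fin.ext
      have := D.cut_mono k n
      simp only [Edge.rng]
      omega⟩

/-- The path `γ_min^k`, `k ∈ {0, 1, …} ∪ {∞}`: it passes through the vertices
`(n, d * n - min k (d * n))` (that is, down the far left side as long as `d * n ≤ k`, and then
through the vertices `(n, d * n - k)`), and always takes the leftmost of the parallel edges. -/
noncomputable def minPath (D : LimitedScopeDiagram) (k : ℕ∞) : D.Path :=
  ⟨fun n =>
    { src := ⟨D.d * n - D.cut k n, by omega⟩
      shift := ⟨D.d - (D.cut k (n + 1) - D.cut k n), by omega⟩
      idx := ⟨0, D.mult_pos _ _ _⟩ },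
    fun n => by
      apply Fin.ext
      have h1 := D.cut_mono k n
      have h2 := D.cut_succ_le k n
      have h3 := D.cut_le k n
      have h4 : D.d * (n + 1) = D.d * n + D.d := by ring
      simp only [Edge.rng]
      omega⟩

/-- The correspondence of the indices in `T (γ_max^k) = γ_min^(swapIndex k)`. -/
noncomputable def swapIndex (k : ℕ∞) : ℕ∞ :=
  if k = 0 then ⊤ else if k = ⊤ then 0 else k

open Classical in
/-- The Bratteli–Vershik transformation `T : X → X`: a path is mapped to its successor, if it has
one. The paths without a successor are the paths all of whose edges are maximal, that is, the
paths `γ_max^k`; there `T (γ_max^k) = γ_min^k` for `0 < k < ∞`, `T (γ_max^0) = γ_min^∞` and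
`T (γ_max^∞) = γ_min^0`. (The last alternative never occurs.) -/
noncomputable def vershik (D : LimitedScopeDiagram) (γ : D.Path) : D.Path :=
  if h : ∃ ξ, γ.IsSucc ξ then h.choose
  else if h : ∃ k, γ = D.maxPath k then D.minPath (swapIndex h.choose)
  else γ

end LimitedScopeDiagram

/-- The Shannon entropy `H_μ(⋁_{i < n} T^{-i} P)`, where the finite partition `P` is given by the
function that maps a point to the number of the atom containing it; the atoms of the join are
indexed by the words `w` of length `n`. -/
noncomputable def joinEntropy {α : Type*} [MeasurableSpace α] (μ : Measure α) (T : α → α)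
    {k : ℕ} (P : α → Fin k) (n : ℕ) : ℝ :=
  ∑ w : Fin n → Fin k, Real.negMulLog (μ.real {x | ∀ i : Fin n, P (T^[i] x) = w i})

/-- The entropy `h_μ(P, T) = lim (1 / n) H_μ(⋁_{i < n} T^{-i} P)` of `T` with respect to the finite
partition `P`. (For `T` preserving the probability measure `μ` the limit exists, so that it is
the upper limit.) -/
noncomputable def partitionEntropy {α : Type*} [MeasurableSpace α] (μ : Measure α) (T : α → α)
    {k : ℕ} (P : α → Fin k) : ENNReal :=
  Filter.limsup (fun n : ℕ => ENNReal.ofReal (joinEntropy μ T P n / n)) Filter.atTop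

/-- The measure-theoretic (Kolmogorov–Sinai) entropy `h_μ(T)`: the supremum of `h_μ(P, T)` over
all finite measurable partitions `P`. -/
noncomputable def measureEntropy {α : Type*} [MeasurableSpace α] (μ : Measure α) (T : α → α) :
    ENNReal :=
  ⨆ (k : ℕ) (P : α → Fin k) (_ : Measurable P), partitionEntropy μ T P

/-! Fix a level `n`. The first `n` edges of a path are coded by its level `n` vertex and by its
`rank` among the finite paths into that vertex. Below the top rank, `T` keeps the vertex and adds
one to the rank; from the top rank it restarts at rank zero, also on the exceptional paths. So the
only new information about the first `n` edges is the next vertex, when it changes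
(`initial_vershik_congr`).

Such changes are rare (`measureReal_vertexChange_le`). A vertex off the two sides carries a tower of
at least `n` floors (`le_height`), so the bases of these towers have total measure at most `1 / n`.
Every entrance into the interior lands in these bases, and by invariance exits are as likely as
entrances. What remains is a jump between the sides. A path at the left side moves at most to vertex
1 (`src_vershik_le_one`), so only jumps from right to left occur; arrivals at the left side are as
likely as departures from it, which again land in the bases. Hence a change has probability at most
`3 / n`, and with only `d * n + 1` vertices its entropy is `O(log n / n)`.

An arbitrary partition is first approximated by sets depending on finitely many edges, at a small
entropy cost. Then `joinEntropy_le` bounds the entropy of the join by a constant plus `N` times a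
rate that becomes arbitrarily small as `n` grows. -/

/-! ### Shannon entropy of finite-valued maps -/

/-- The pointwise form of Gibbs' inequality, from `log x ≤ x - 1` at `x = q / p`. Every upper bound
below obtained by comparison with a reference distribution sums it over the atoms. -/
theorem negMulLog_le_of_nonneg {p q : ℝ} (hp : 0 ≤ p) (hq : 0 ≤ q) (h : q = 0 → p = 0) :
    Real.negMulLog p ≤ -(p * Real.log q) + q - p := by
  rcases hp.eq_or_lt with rfl | hp'
  · simpa using hq
  have hq' : 0 < q := hq.lt_of_ne fun h' => hp'.ne' (h h'.symm)
  have h1 := Real.log_le_sub_one_of_pos (div_pos hq' hp')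
  rw [Real.log_div hq'.ne' hp'.ne'] at h1
  have h2 := mul_le_mul_of_nonneg_left h1 hp
  have h3 : p * (q / p - 1) = q - p := by field_simp
  rw [h3] at h2
  rw [Real.negMulLog]
  linarith

theorem negMulLog_sum_le {ι : Type*} (s : Finset ι) (q : ι → ℝ) (hq : ∀ i ∈ s, 0 ≤ q i) :
    Real.negMulLog (∑ i ∈ s, q i) ≤ ∑ i ∈ s, Real.negMulLog (q i) := by
  rw [Real.negMulLog, ← Finset.sum_neg_distrib, Finset.sum_mul]
  refine Finset.sum_le_sum fun i hi => ?_
  rcases (hq i hi).eq_or_lt with h | h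
  · simp [← h]
  have := Real.log_le_log h (Finset.single_le_sum hq hi)
  rw [Real.negMulLog]
  nlinarith

/-- The Shannon entropy of the partition of `α` into the fibres of `X`. -/
noncomputable def fiberEntropy {α ι : Type*} [Fintype ι] [MeasurableSpace α] (μ : Measure α)
    (X : α → ι) : ℝ :=
  ∑ i, Real.negMulLog (μ.real (X ⁻¹' {i}))

theorem measurableSet_fiber_pair {α ι κ : Type*} [MeasurableSpace α] {X : α → ι} {Y : α → κ} (hX : ∀ i, MeasurableSet (X ⁻¹' {i}))
    (hY : ∀ j, MeasurableSet (Y ⁻¹' {j})) (z : ι × κ) :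
    MeasurableSet ((fun x => (X x, Y x)) ⁻¹' {z}) := by
  convert (hX z.1).inter (hY z.2) using 1
  ext x; simp [Prod.ext_iff]

theorem measurableSet_fiber_pi {α κ : Type*} [MeasurableSpace α] {N : ℕ} {Y : Fin N → α → κ}
    (hY : ∀ i j, MeasurableSet (Y i ⁻¹' {j})) (w : Fin N → κ) :
    MeasurableSet ((fun x i => Y i x) ⁻¹' {w}) := by
  convert MeasurableSet.iInter fun i => hY i (w i) using 1
  ext x; simp [funext_iff]

theorem fiberEntropy_comp_iterate {α κ : Type*} [Fintype κ] [MeasurableSpace α] {μ : Measure α}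
    {T : α → α} (hT : MeasurePreserving T μ μ) {Y : α → κ}
    (hY : ∀ j, MeasurableSet (Y ⁻¹' {j})) (n : ℕ) :
    fiberEntropy μ (fun x => Y (T^[n] x)) = fiberEntropy μ Y := by
  refine Finset.sum_congr rfl fun j _ => ?_
  have := (hT.iterate n).measureReal_preimage (hY j).nullMeasurableSet
  rw [← this]; rfl

section FiberEntropy

variable {α ι κ : Type*} [Fintype ι] [Fintype κ] [MeasurableSpace α] {μ : Measure α}
  [IsProbabilityMeasure μ]

theorem fiberEntropy_nonneg (X : α → ι) : 0 ≤ fiberEntropy μ X :=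
  Finset.sum_nonneg fun _ _ => Real.negMulLog_nonneg measureReal_nonneg measureReal_le_one

theorem sum_measureReal_fiber {X : α → ι} (hX : ∀ i, MeasurableSet (X ⁻¹' {i})) :
    ∑ i, μ.real (X ⁻¹' {i}) = 1 := by
  rw [sum_measureReal_preimage_singleton _ fun i _ => hX i]
  simp

/-- The hypothesis makes `X` a function of `Y`, so its atoms are unions of atoms of `Y`, and merging
atoms does not increase entropy. -/
theorem fiberEntropy_le_of_factor {X : α → ι} {Y : α → κ} (hY : ∀ j, MeasurableSet (Y ⁻¹' {j}))
    (h : ∀ x y, Y x = Y y → X x = X y) : fiberEntropy μ X ≤ fiberEntropy μ Y := by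
  classical
  obtain ⟨x₀⟩ : Nonempty α := nonempty_of_isProbabilityMeasure μ
  obtain ⟨f, hf⟩ : ∃ f : κ → ι, ∀ x, f (Y x) = X x := by
    refine ⟨fun j => if hj : ∃ x, Y x = j then X hj.choose else X x₀, fun x => ?_⟩
    have hx : ∃ y, Y y = Y x := ⟨x, rfl⟩
    simp only [hx, dite_true]
    exact h _ _ hx.choose_spec
  have key : ∀ i, Real.negMulLog (μ.real (X ⁻¹' {i})) ≤
      ∑ j with f j = i, Real.negMulLog (μ.real (Y ⁻¹' {j})) := fun i => by
    have : X ⁻¹' {i} = Y ⁻¹' ↑(Finset.univ.filter fun j => f j = i) := by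
      ext x; simp [hf]
    rw [this, ← sum_measureReal_preimage_singleton _ fun j _ => hY j]
    exact negMulLog_sum_le _ _ fun _ _ => measureReal_nonneg
  refine (Finset.sum_le_sum fun i _ => key i).trans_eq ?_
  exact Finset.sum_fiberwise _ _ _

/-- Gibbs' inequality for the joint distribution against the product of its marginals; both have
total mass 1, so the linear terms cancel. -/
theorem fiberEntropy_pair_le {X : α → ι} {Y : α → κ} (hX : ∀ i, MeasurableSet (X ⁻¹' {i}))
    (hY : ∀ j, MeasurableSet (Y ⁻¹' {j})) :
    fiberEntropy μ (fun x => (X x, Y x)) ≤ fiberEntropy μ X + fiberEntropy μ Y := by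
  classical
  set p : ι × κ → ℝ := fun z => μ.real ((fun x => (X x, Y x)) ⁻¹' {z})
  set a : ι → ℝ := fun i => μ.real (X ⁻¹' {i})
  set b : κ → ℝ := fun j => μ.real (Y ⁻¹' {j})
  have hXY := measurableSet_fiber_pair hX hY
  have hpa : ∀ i, ∑ j, p (i, j) = a i := fun i => by
    have := sum_measureReal_preimage_singleton (μ := μ) (({i} : Finset ι) ×ˢ (Finset.univ : Finset κ))
      fun z _ => hXY z
    rw [Finset.sum_product, Finset.sum_singleton] at this
    refine this.trans (congrArg μ.real ?_)
    ext x; simp [eq_comm]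
  have hpb : ∀ j, ∑ i, p (i, j) = b j := fun j => by
    have := sum_measureReal_preimage_singleton (μ := μ) ((Finset.univ : Finset ι) ×ˢ ({j} : Finset κ))
      fun z _ => hXY z
    rw [Finset.sum_product_right, Finset.sum_singleton] at this
    refine this.trans (congrArg μ.real ?_)
    ext x; simp [eq_comm]
  have hp0 : ∀ z, 0 ≤ p z := fun z => measureReal_nonneg
  have hle_a : ∀ z, p z ≤ a z.1 := fun z => by
    rw [← hpa]; exact Finset.single_le_sum (f := fun j => p (z.1, j)) (fun _ _ => hp0 _) (Finset.mem_univ z.2)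
  have hle_b : ∀ z, p z ≤ b z.2 := fun z => by
    rw [← hpb]; exact Finset.single_le_sum (f := fun i => p (i, z.2)) (fun _ _ => hp0 _) (Finset.mem_univ z.1)
  have ha : ∑ i, a i = 1 := sum_measureReal_fiber hX
  have hb : ∑ j, b j = 1 := sum_measureReal_fiber hY
  have hp : ∑ z, p z = 1 := sum_measureReal_fiber hXY
  have key : ∀ z, Real.negMulLog (p z) ≤
      -(p z * Real.log (a z.1)) + -(p z * Real.log (b z.2)) + a z.1 * b z.2 - p z := fun z => by
    rcases (hp0 z).eq_or_lt with h | h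
    · rw [← h]; simp [a, b]; positivity
    have h1 : 0 < a z.1 := h.trans_le (hle_a z)
    have h2 : 0 < b z.2 := h.trans_le (hle_b z)
    have := negMulLog_le_of_nonneg h.le (mul_pos h1 h2).le fun h' => absurd h' (mul_pos h1 h2).ne'
    rw [Real.log_mul h1.ne' h2.ne', mul_add] at this
    linarith
  calc fiberEntropy μ (fun x => (X x, Y x)) ≤ ∑ z : ι × κ,
      (-(p z * Real.log (a z.1)) + -(p z * Real.log (b z.2)) + a z.1 * b z.2 - p z) :=
        Finset.sum_le_sum fun z _ => key z
    _ = fiberEntropy μ X + fiberEntropy μ Y := by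
      rw [Finset.sum_sub_distrib, Finset.sum_add_distrib, Finset.sum_add_distrib, hp]
      have e1 : ∑ z : ι × κ, -(p z * Real.log (a z.1)) = fiberEntropy μ X := by
        rw [Fintype.sum_prod_type]
        refine Finset.sum_congr rfl fun i _ => ?_
        simp only [Finset.sum_neg_distrib, ← Finset.sum_mul, hpa, Real.negMulLog, a, neg_mul]
      have e2 : ∑ z : ι × κ, -(p z * Real.log (b z.2)) = fiberEntropy μ Y := by
        rw [Fintype.sum_prod_type_right]
        refine Finset.sum_congr rfl fun i _ => ?_
        simp only [Finset.sum_neg_distrib, ← Finset.sum_mul, hpb, Real.negMulLog, b, neg_mul]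
      have e3 : ∑ z : ι × κ, a z.1 * b z.2 = 1 := by
        rw [Fintype.sum_prod_type]
        simp only [← Finset.mul_sum, hb, mul_one, ha]
      rw [e1, e2, e3]; ring

theorem fiberEntropy_pi_le {N : ℕ} {Y : Fin N → α → κ}
    (hY : ∀ i j, MeasurableSet (Y i ⁻¹' {j})) :
    fiberEntropy μ (fun x i => Y i x) ≤ ∑ i, fiberEntropy μ (Y i) := by
  induction N with
  | zero => simp [fiberEntropy, Set.preimage, funext_iff]
  | succ N ih =>
    rw [Fin.sum_univ_castSucc]
    have hw := measurableSet_fiber_pi fun i : Fin N => hY i.castSucc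
    refine (fiberEntropy_le_of_factor (Y := fun x => ((fun i : Fin N => Y i.castSucc x), Y (Fin.last N) x))
      (measurableSet_fiber_pair hw (hY _)) fun x y h => ?_).trans
      ((fiberEntropy_pair_le hw (hY _)).trans (by gcongr; exact ih fun i => hY _))
    obtain ⟨h1, h2⟩ := Prod.ext_iff.mp h
    funext i
    induction i using Fin.lastCases with
    | last => exact h2
    | cast i => exact congrFun h1 i

theorem fiberEntropy_word_le {T : α → α} (hT : MeasurePreserving T μ μ) {Y : α → κ}
    (hY : ∀ j, MeasurableSet (Y ⁻¹' {j})) (N : ℕ) :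
    fiberEntropy μ (fun x (i : Fin N) => Y (T^[i] x)) ≤ N * fiberEntropy μ Y := by
  refine (fiberEntropy_pi_le (Y := fun (i : Fin N) x => Y (T^[i] x)) fun i j =>
    (hT.iterate i).measurable (hY j)).trans_eq ?_
  simp [fiberEntropy_comp_iterate hT hY]

/-- A partition all of whose atoms but one have a small union has small entropy. -/
theorem fiberEntropy_option_le {a : ℕ} (ha : 0 < a) {X : α → Option (Fin a)}
    (hX : ∀ o, MeasurableSet (X ⁻¹' {o})) {p δ : ℝ} (hp : μ.real {x | X x ≠ none} ≤ p)
    (hδ : 0 < δ) (hδ1 : δ < 1) :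
    fiberEntropy μ X ≤ -Real.log (1 - δ) + p * Real.log (a / δ) := by
  have ha' : (1 : ℝ) ≤ a := by exact_mod_cast ha
  have ha0 : (0 : ℝ) < a := by linarith
  set r : ℝ := μ.real (X ⁻¹' {none})
  set P : Fin a → ℝ := fun j => μ.real (X ⁻¹' {some j})
  have hsum : r + ∑ j, P j = 1 := by
    rw [← sum_measureReal_fiber (μ := μ) hX, Fintype.sum_option]
  have hr : μ.real {x | X x ≠ none} = 1 - r := by
    have := probReal_compl_eq_one_sub (μ := μ) (hX none)
    rw [← this]; rfl
  rw [fiberEntropy, Fintype.sum_option]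
  -- The reference distribution gives mass `1 - δ` to `none` and `δ / a` to each other value.
  have h1 : Real.negMulLog r ≤ -(r * Real.log (1 - δ)) + (1 - δ) - r :=
    negMulLog_le_of_nonneg measureReal_nonneg (by linarith) fun h => by linarith
  have h2 : ∑ j, Real.negMulLog (P j) ≤ ∑ j, (-(P j * Real.log (δ / a)) + δ / a - P j) :=
    Finset.sum_le_sum fun j _ => negMulLog_le_of_nonneg measureReal_nonneg (by positivity)
      fun h => absurd h (by positivity)
  rw [Finset.sum_sub_distrib, Finset.sum_add_distrib, Finset.sum_neg_distrib, ← Finset.sum_mul,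
    Finset.sum_const, Finset.card_univ, Fintype.card_fin, nsmul_eq_mul,
    mul_div_cancel₀ _ ha0.ne'] at h2
  have h3 : Real.log (δ / a) = -Real.log (a / δ) := by rw [← Real.log_inv, inv_div]
  have h4 : 0 ≤ Real.log (a / δ) := Real.log_nonneg (by rw [le_div_iff₀ hδ]; linarith)
  have h5 : Real.log (1 - δ) ≤ 0 := Real.log_nonpos (by linarith) (by linarith)
  have h6 : r ≤ 1 := measureReal_le_one
  have h7 : ∑ j, P j = 1 - r := by linarith
  rw [h3, h7] at h2
  have h8 : (1 - r) * Real.log (a / δ) ≤ p * Real.log (a / δ) := by gcongr; linarith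
  have h9 : r * Real.log (1 - δ) ≥ Real.log (1 - δ) := by nlinarith
  linarith

end FiberEntropy

/-! ### Entropy rates, invariance and approximation of partitions -/

theorem joinEntropy_eq_fiberEntropy {α : Type*} [MeasurableSpace α] (μ : Measure α) (T : α → α)
    {k : ℕ} (P : α → Fin k) (n : ℕ) :
    joinEntropy μ T P n = fiberEntropy μ (fun x (i : Fin n) => P (T^[i] x)) := by
  refine Finset.sum_congr rfl fun w _ => ?_
  congr 2
  ext x; simp [funext_iff]

theorem partitionEntropy_le_of_joinEntropy_le {α : Type*} [MeasurableSpace α] {μ : Measure α}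
    {T : α → α} {k : ℕ} {P : α → Fin k} {C c : ℝ}
    (h : ∀ n : ℕ, joinEntropy μ T P n ≤ C + n * c) :
    partitionEntropy μ T P ≤ ENNReal.ofReal c := by
  have h1 : Filter.Tendsto (fun n : ℕ => ENNReal.ofReal (C / n + c)) Filter.atTop
      (nhds (ENNReal.ofReal c)) := by
    refine ENNReal.tendsto_ofReal ?_
    simpa using (tendsto_const_div_atTop_nhds_zero_nat C).add_const c
  rw [← h1.limsup_eq]
  refine Filter.limsup_le_limsup ?_
  filter_upwards [Filter.eventually_gt_atTop 0] with n hn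
  refine ENNReal.ofReal_le_ofReal ?_
  have hn' : (0 : ℝ) < n := by exact_mod_cast hn
  rw [div_le_iff₀ hn', add_mul, div_mul_cancel₀ _ hn'.ne']
  linarith [h n]

/-- Both sides equal `μ A` minus the measure of `A ∩ T ⁻¹' A`. -/
theorem measureReal_exit_eq_enter {α : Type*} [MeasurableSpace α] {μ : Measure α}
    [IsFiniteMeasure μ] {T : α → α} (hT : MeasurePreserving T μ μ) {A : Set α}
    (hA : MeasurableSet A) : μ.real (A \ T ⁻¹' A) = μ.real (T ⁻¹' A \ A) := by
  have h1 := measureReal_inter_add_sdiff (μ := μ) (s := A) (hT.measurable hA)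
  have h2 := measureReal_inter_add_sdiff (μ := μ) (s := T ⁻¹' A) hA
  rw [hT.measureReal_preimage hA.nullMeasurableSet, Set.inter_comm] at h2
  linarith

open Classical in
/-- The value of `P`, recorded only where the atoms of `P` and the sets `B i` disagree. -/
noncomputable def discrepancy {α : Type*} {k : ℕ} (P : α → Fin k) (B : Fin k → Set α) (x : α) :
    Option (Fin k) :=
  if ∀ i, P x = i ↔ x ∈ B i then none else some (P x)

/-- The sets `B i` need not form a partition: where they fail to describe `P`, the discrepancy
itself carries its value. -/
theorem eq_of_discrepancy_eq {α : Type*} {k : ℕ} {P : α → Fin k} {B : Fin k → Set α} {x y : α}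
    (h : discrepancy P B x = discrepancy P B y) (hB : ∀ i, x ∈ B i ↔ y ∈ B i) : P x = P y := by
  unfold discrepancy at h
  split_ifs at h with h1 h2
  · exact ((h2 _).mpr ((hB _).mp ((h1 _).mp rfl))).symm
  · exact Option.some.inj h

theorem measurableSet_discrepancy {α : Type*} [MeasurableSpace α] {k : ℕ} {P : α → Fin k}
    (hP : Measurable P) {B : Fin k → Set α} (hB : ∀ i, MeasurableSet (B i)) (o : Option (Fin k)) :
    MeasurableSet (discrepancy P B ⁻¹' {o}) := by
  have h1 : ∀ i, MeasurableSet {x | P x = i} := fun i => hP (MeasurableSet.singleton i)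
  have h2 : MeasurableSet {x | ∀ i, P x = i ↔ x ∈ B i} := by
    rw [Set.ofPred_forall]
    exact MeasurableSet.iInter fun i => (h1 i).iff (hB i)
  cases o with
  | none => convert h2 using 1; ext x; simp [discrepancy]
  | some j =>
    convert (h1 j).diff h2 using 1
    ext x
    simp only [discrepancy, Set.mem_preimage, Set.mem_singleton_iff, Set.mem_sdiff,
      Set.mem_ofPred_eq]
    split_ifs with h <;> simp [h]

/-! ### Edges, heights and offsets -/

namespace LimitedScopeDiagram

variable {D : LimitedScopeDiagram}

noncomputable instance (n : ℕ) : Fintype (D.Edge n) := Fintype.ofFinite _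

namespace Edge

variable {n : ℕ}

theorem ext_val {e f : D.Edge n} (h1 : (e.src : ℕ) = f.src) (h2 : (e.shift : ℕ) = f.shift)
    (h3 : (e.idx : ℕ) = f.idx) : e = f := by
  obtain ⟨a, b, c⟩ := e
  obtain ⟨a', b', c'⟩ := f
  obtain rfl : a = a' := Fin.ext h1
  obtain rfl : b = b' := Fin.ext h2
  obtain rfl : c = c' := Fin.ext h3
  rfl

theorem rng_val (e : D.Edge n) : (e.rng : ℕ) = e.src + e.shift := rfl

theorem Below.irrefl (e : D.Edge n) : ¬ e.Below e := by
  rintro ⟨-, h | h⟩ <;> omega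

theorem Below.trans {e f g : D.Edge n} (h1 : e.Below f) (h2 : f.Below g) : e.Below g := by
  obtain ⟨h1, h1'⟩ := h1
  obtain ⟨h2, h2'⟩ := h2
  exact ⟨h1.trans h2, by omega⟩

theorem below_trichotomy {e f : D.Edge n} (h : e.rng = f.rng) : e.Below f ∨ e = f ∨ f.Below e := by
  have h' : (e.src : ℕ) + e.shift = f.src + f.shift := congrArg Fin.val h
  by_cases h1 : (e.src : ℕ) = f.src
  · rcases lt_trichotomy (e.idx : ℕ) f.idx with h2 | h2 | h2
    · exact .inl ⟨h, .inr ⟨h1, h2⟩⟩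
    · exact .inr (.inl (ext_val h1 (by omega) h2))
    · exact .inr (.inr ⟨h.symm, .inr ⟨h1.symm, h2⟩⟩)
  · rcases Nat.lt_or_gt_of_ne h1 with h2 | h2
    · exact .inl ⟨h, .inl h2⟩
    · exact .inr (.inr ⟨h.symm, .inl h2⟩)

theorem exists_src_rng {s : ℕ} (hs : s ≤ D.d * n) {v : Fin (D.d * (n + 1) + 1)} (h1 : s ≤ v)
    (h2 : v ≤ s + D.d) : ∃ e : D.Edge n, (e.src : ℕ) = s ∧ e.rng = v :=
  ⟨⟨⟨s, by omega⟩, ⟨v - s, by omega⟩, ⟨0, D.mult_pos _ _ _⟩⟩, rfl, by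
    apply Fin.ext; simp only [rng_val]; omega⟩

theorem exists_rng (v : Fin (D.d * (n + 1) + 1)) : ∃ e : D.Edge n, e.rng = v := by
  have := v.isLt
  have := Nat.mul_add D.d n 1
  obtain ⟨e, -, he⟩ := exists_src_rng (n := n) (s := min v (D.d * n)) (by omega) (v := v)
    (by omega) (by omega)
  exact ⟨e, he⟩

/-- Otherwise the vertex one step to the right of the source also has an edge to the same terminal
vertex. -/
theorem src_eq_of_maximal {e : D.Edge n} (h : ∀ f, ¬ e.Below f) :
    (e.src : ℕ) = min (e.rng : ℕ) (D.d * n) := by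
  have h1 := e.src.isLt
  have h2 := e.shift.isLt
  have h3 := e.rng_val
  by_contra hne
  obtain ⟨f, hf, hf'⟩ := exists_src_rng (n := n) (s := e.src + 1) (by omega) (v := e.rng)
    (by omega) (by omega)
  exact h f ⟨hf'.symm, .inl (by omega)⟩

theorem idx_eq_of_maximal {e : D.Edge n} (h : ∀ f, ¬ e.Below f) :
    (e.idx : ℕ) = D.mult n e.src e.shift - 1 := by
  have h1 := e.idx.isLt
  by_contra hne
  exact h ⟨e.src, e.shift, ⟨e.idx + 1, by omega⟩⟩ ⟨rfl, .inr ⟨rfl, Nat.lt_succ_self _⟩⟩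

end Edge

open Classical in
/-- The number of finite paths from the root to a vertex. -/
noncomputable def height (D : LimitedScopeDiagram) : (n : ℕ) → Fin (D.d * n + 1) → ℕ
  | 0, _ => 1
  | n + 1, v => ∑ e : D.Edge n with e.rng = v, height D n e.src

open Classical in
/-- The number of finite paths from the root whose last edge is below a given edge. -/
noncomputable def Edge.offset {n : ℕ} (e : D.Edge n) : ℕ :=
  ∑ f : D.Edge n with f.Below e, D.height n f.src

theorem height_pos (n : ℕ) (v : Fin (D.d * n + 1)) : 0 < D.height n v := by
  classical
  induction n with
  | zero => simp [height]
  | succ n ih =>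
    obtain ⟨e, he⟩ := Edge.exists_rng v
    rw [height]
    exact (ih e.src).trans_le
      (Finset.single_le_sum (f := fun e : D.Edge n => D.height n e.src) (fun _ _ => Nat.zero_le _)
        (Finset.mem_filter.mpr ⟨Finset.mem_univ _, he⟩))

namespace Edge

variable {n : ℕ}

/-- The intervals of length `height` starting at `offset`, over the edges into one vertex, are
disjoint and ordered like the edges. The following lemmas show that they tile the interval from 0 to
the height of that vertex. -/
theorem offset_add_height_le {e f : D.Edge n} (h : e.Below f) :
    e.offset + D.height n e.src ≤ f.offset := by
  classical
  rw [offset, offset, add_comm, ← Finset.sum_insert (f := fun e : D.Edge n => D.height n e.src)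
    (by simpa using Below.irrefl e)]
  refine Finset.sum_le_sum_of_subset fun g hg => ?_
  simp only [Finset.mem_insert, Finset.mem_filter, Finset.mem_univ, true_and] at hg ⊢
  rcases hg with rfl | hg
  exacts [h, hg.trans h]

theorem offset_add_height_le_height (e : D.Edge n) :
    e.offset + D.height n e.src ≤ D.height (n + 1) e.rng := by
  classical
  rw [offset, height, add_comm, ← Finset.sum_insert (f := fun e : D.Edge n => D.height n e.src)
    (by simpa using Below.irrefl e)]
  refine Finset.sum_le_sum_of_subset fun g hg => ?_
  simp only [Finset.mem_insert, Finset.mem_filter, Finset.mem_univ, true_and] at hg ⊢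
  rcases hg with rfl | hg
  exacts [rfl, hg.1]

theorem offset_add_height_eq_height {e : D.Edge n} (h : ∀ f, ¬ e.Below f) :
    e.offset + D.height n e.src = D.height (n + 1) e.rng := by
  classical
  rw [offset, height, add_comm, ← Finset.sum_insert (f := fun e : D.Edge n => D.height n e.src)
    (by simpa using Below.irrefl e)]
  refine Finset.sum_congr (Finset.ext fun g => ?_) fun _ _ => rfl
  simp only [Finset.mem_insert, Finset.mem_filter, Finset.mem_univ, true_and]
  constructor
  · rintro (rfl | hg)
    exacts [rfl, hg.1]
  · intro hg
    rcases below_trichotomy hg with h' | h' | h'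
    exacts [.inr h', .inl h', absurd h' (h g)]

theorem not_below_of_offset_add_height_eq {e : D.Edge n}
    (h : e.offset + D.height n e.src = D.height (n + 1) e.rng) (f : D.Edge n) : ¬ e.Below f := by
  intro hf
  have h1 := offset_add_height_le hf
  have h2 := f.offset_add_height_le_height
  have h3 := D.height_pos n f.src
  rw [← hf.1] at h2
  omega

theorem exists_offset_eq {e f : D.Edge n} (h : e.Below f) :
    ∃ g, e.Below g ∧ g.offset = e.offset + D.height n e.src := by
  classical
  obtain ⟨g, hg, hmin⟩ := Finset.exists_min_image (Finset.univ.filter fun g => e.Below g)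
    (fun g => g.offset) ⟨f, by simpa using h⟩
  simp only [Finset.mem_filter, Finset.mem_univ, true_and] at hg hmin
  refine ⟨g, hg, ?_⟩
  rw [offset, offset, add_comm, ← Finset.sum_insert (f := fun e : D.Edge n => D.height n e.src)
    (by simpa using Below.irrefl e)]
  refine Finset.sum_congr (Finset.ext fun i => ?_) fun _ _ => rfl
  simp only [Finset.mem_insert, Finset.mem_filter, Finset.mem_univ, true_and]
  constructor
  · intro hi
    rcases below_trichotomy (hi.1.trans hg.1.symm) with h' | h' | h'
    · exact .inr h'
    · exact .inl h'
    · have h1 := hmin i h'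
      have h2 := offset_add_height_le hi
      have h3 := D.height_pos n i.src
      omega
  · rintro (rfl | hi)
    exacts [hg, hi.trans hg]

theorem exists_offset_eq_zero (v : Fin (D.d * (n + 1) + 1)) :
    ∃ e : D.Edge n, e.rng = v ∧ e.offset = 0 := by
  classical
  obtain ⟨e₀, he₀⟩ := exists_rng v
  obtain ⟨e, he, hmin⟩ := Finset.exists_min_image (Finset.univ.filter fun g : D.Edge n => g.rng = v)
    (fun g => g.offset) ⟨e₀, by simpa using he₀⟩
  simp only [Finset.mem_filter, Finset.mem_univ, true_and] at he hmin
  refine ⟨e, he, Finset.sum_eq_zero fun f hf => ?_⟩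
  simp only [Finset.mem_filter, Finset.mem_univ, true_and] at hf
  have h1 := hmin f (hf.1.trans he)
  have h2 := offset_add_height_le hf
  have h3 := D.height_pos n f.src
  omega

theorem exists_offset_le (v : Fin (D.d * (n + 1) + 1)) {r : ℕ} (hr : r < D.height (n + 1) v) :
    ∃ e : D.Edge n, e.rng = v ∧ e.offset ≤ r ∧ r < e.offset + D.height n e.src := by
  induction r with
  | zero =>
    obtain ⟨e, he, he'⟩ := exists_offset_eq_zero v
    exact ⟨e, he, he'.le, by have := D.height_pos n e.src; omega⟩
  | succ r ih =>
    obtain ⟨e, he, h1, h2⟩ := ih (by omega)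
    by_cases h3 : r + 1 < e.offset + D.height n e.src
    · exact ⟨e, he, by omega, h3⟩
    by_cases h4 : ∃ f, e.Below f
    · obtain ⟨g, hg, hg'⟩ := exists_offset_eq h4.choose_spec
      exact ⟨g, hg.1.symm.trans he, by omega, by have := D.height_pos n g.src; omega⟩
    · push Not at h4
      have := offset_add_height_eq_height h4
      rw [he] at this
      omega

end Edge

/-- Vertices off the two sides of the diagram are the end points of many paths. -/
theorem le_height {n : ℕ} {v : Fin (D.d * n + 1)} (h0 : 0 < (v : ℕ)) (h1 : (v : ℕ) < D.d * n) :
    n ≤ D.height n v := by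
  classical
  induction n with
  | zero => simp
  | succ n ih =>
    rcases Nat.eq_zero_or_pos n with rfl | hn
    · exact D.height_pos _ v
    have hd := D.d_pos
    have hdn : D.d ≤ D.d * n := Nat.le_mul_of_pos_right _ hn
    have hmul := Nat.mul_add D.d n 1
    -- Sources `v - d` (truncated) and `v - d + 1`: except when `d * n = 1`, one of them is interior
    -- and contributes at least `n` paths, the other at least one.
    obtain ⟨e, he, he'⟩ := Edge.exists_src_rng (n := n) (s := v - D.d) (by omega) (v := v)
      (by omega) (by omega)
    obtain ⟨f, hf, hf'⟩ := Edge.exists_src_rng (n := n) (s := v - D.d + 1) (by omega) (v := v)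
      (by omega) (by omega)
    have hef : e ≠ f := by rintro rfl; omega
    have hsum : D.height n e.src + D.height n f.src ≤ D.height (n + 1) v := by
      rw [height, ← Finset.sum_pair (f := fun e : D.Edge n => D.height n e.src) hef]
      refine Finset.sum_le_sum_of_subset fun g hg => ?_
      simp only [Finset.mem_insert, Finset.mem_singleton] at hg
      rcases hg with rfl | rfl <;> simpa
    have pe := D.height_pos n e.src
    have pf := D.height_pos n f.src
    by_cases h2 : 0 < (e.src : ℕ)
    · have := ih h2 (by omega)
      omega
    by_cases h3 : 1 < D.d * n
    · have := ih (v := f.src) (by omega) (by omega)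
      omega
    · have : n ≤ D.d * n := Nat.le_mul_of_pos_left _ hd
      omega

/-! ### Ranks of finite paths -/

namespace Path

/-- The number of finite paths with the same terminal vertex as the first `n` edges of `γ` that
precede these. -/
noncomputable def rank (n : ℕ) (γ : D.Path) : ℕ :=
  ∑ i ∈ Finset.range n, (γ.1 i).offset

/-- The two paths agree from level `n` on. -/
def TailEq (n : ℕ) (γ ξ : D.Path) : Prop :=
  ∀ m, n ≤ m → γ.1 m = ξ.1 m

theorem TailEq.mono {n m : ℕ} {γ ξ : D.Path} (h : TailEq n γ ξ) (hnm : n ≤ m) : TailEq m γ ξ :=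
  fun i hi => h i (hnm.trans hi)

theorem TailEq.symm {n : ℕ} {γ ξ : D.Path} (h : TailEq n γ ξ) : TailEq n ξ γ :=
  fun i hi => (h i hi).symm

theorem TailEq.trans {n : ℕ} {γ ξ ζ : D.Path} (h : TailEq n γ ξ) (h' : TailEq n ξ ζ) :
    TailEq n γ ζ :=
  fun i hi => (h i hi).trans (h' i hi)

theorem rank_succ (n : ℕ) (γ : D.Path) : rank (n + 1) γ = rank n γ + (γ.1 n).offset :=
  Finset.sum_range_succ _ _

theorem rank_mono {n m : ℕ} (h : n ≤ m) (γ : D.Path) : rank n γ ≤ rank m γ :=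
  Finset.sum_le_sum_of_subset (Finset.range_mono h)

/-- Common edges add the same offsets, so the difference of the ranks is constant from level `n` on;
it is stated without subtraction. -/
theorem TailEq.rank_add_rank {n m : ℕ} {γ ξ : D.Path} (h : TailEq n γ ξ) (hnm : n ≤ m) :
    rank m γ + rank n ξ = rank m ξ + rank n γ := by
  induction m, hnm using Nat.le_induction with
  | base => omega
  | succ m hm ih =>
    rw [rank_succ, rank_succ, h m hm]
    omega

theorem rank_lt_height (n : ℕ) (γ : D.Path) : rank n γ < D.height n (γ.1 n).src := by
  induction n with
  | zero => simp [rank, height]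
  | succ n ih =>
    rw [rank_succ, ← γ.2 n]
    have := (γ.1 n).offset_add_height_le_height
    omega

theorem rank_lt_of_below {n : ℕ} {γ ξ : D.Path} (h : γ.Below ξ) (ht : TailEq n γ ξ) :
    rank n γ < rank n ξ := by
  obtain ⟨j, hj, hj'⟩ := h
  have hjn : j < n := by
    by_contra hle
    rw [ht j (not_lt.mp hle)] at hj
    exact Edge.Below.irrefl _ hj
  have h1 := TailEq.rank_add_rank (n := j + 1) (m := n) (γ := γ) (ξ := ξ) (fun m hm => hj' m hm) hjn
  have h2 := Edge.offset_add_height_le hj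
  have h3 := rank_lt_height j γ
  rw [rank_succ, rank_succ] at h1
  omega

theorem TailEq.trichotomy {n : ℕ} {γ ξ : D.Path} (h : TailEq n γ ξ) :
    γ = ξ ∨ γ.Below ξ ∨ ξ.Below γ := by
  induction n with
  | zero => exact .inl (Subtype.ext (funext fun m => h m (Nat.zero_le m)))
  | succ n ih =>
    have hr : (γ.1 n).rng = (ξ.1 n).rng := by rw [γ.2, ξ.2, h _ le_rfl]
    rcases Edge.below_trichotomy hr with h' | h' | h'
    · exact .inr (.inl ⟨n, h', fun m hm => h m hm⟩)
    · refine ih fun m hm => ?_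
      rcases hm.eq_or_lt with rfl | hm
      exacts [h', h m hm]
    · exact .inr (.inr ⟨n, h', fun m hm => (h m hm).symm⟩)

theorem TailEq.below_iff {n : ℕ} {γ ξ : D.Path} (h : TailEq n γ ξ) :
    γ.Below ξ ↔ rank n γ < rank n ξ := by
  refine ⟨fun h' => rank_lt_of_below h' h, fun h' => ?_⟩
  rcases h.trichotomy with rfl | h1 | h1
  · omega
  · exact h1
  · have := rank_lt_of_below h1 h.symm
    omega

theorem exists_eq_of_tail {n : ℕ} (γ : (m : ℕ) → D.Edge m)
    (h : ∀ m, n ≤ m → (γ m).rng = (γ (m + 1)).src) : ∃ ξ : D.Path, ∀ m, n ≤ m → ξ.1 m = γ m := by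
  induction n generalizing γ with
  | zero => exact ⟨⟨γ, fun m => h m (Nat.zero_le m)⟩, fun _ _ => rfl⟩
  | succ n ih =>
    obtain ⟨e, he⟩ := Edge.exists_rng (γ (n + 1)).src
    obtain ⟨ξ, hξ⟩ := ih (Function.update γ n e) fun m hm => by
      rcases hm.eq_or_lt with rfl | hm
      · rwa [Function.update_self, Function.update_of_ne (by omega)]
      · rw [Function.update_of_ne (by omega), Function.update_of_ne (by omega)]
        exact h m hm
    exact ⟨ξ, fun m hm => by rw [hξ m (by omega), Function.update_of_ne (by omega)]⟩

/-- A greedy expansion of `r`: the last edge is the one whose offset interval contains `r`, and the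
remainder is the rank sought one level earlier. -/
theorem exists_rank_eq {n r : ℕ} (γ : D.Path) (hr : r < D.height n (γ.1 n).src) :
    ∃ ξ : D.Path, TailEq n γ ξ ∧ rank n ξ = r := by
  induction n generalizing γ r with
  | zero =>
    rw [height] at hr
    exact ⟨γ, fun _ _ => rfl, by simp [rank]; omega⟩
  | succ n ih =>
    obtain ⟨e, he, h1, h2⟩ := Edge.exists_offset_le _ hr
    obtain ⟨ξ, hξ⟩ := exists_eq_of_tail (n := n) (Function.update γ.1 n e) fun m hm => by
      rcases hm.eq_or_lt with rfl | hm
      · rwa [Function.update_self, Function.update_of_ne (by omega)]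
      · rw [Function.update_of_ne (by omega), Function.update_of_ne (by omega)]
        exact γ.2 m
    have hξn : ξ.1 n = e := by rw [hξ n le_rfl, Function.update_self]
    obtain ⟨ζ, hζ, hζr⟩ := ih (r := r - e.offset) ξ (by rw [hξn]; omega)
    refine ⟨ζ, fun m hm => ?_, ?_⟩
    · rw [← hζ m (by omega), hξ m (by omega), Function.update_of_ne (by omega)]
    · rw [rank_succ, hζr, ← hζ n le_rfl, hξn]
      omega

/-- Uniqueness of this expansion: the offset intervals are disjoint, so the rank determines the last
edge, then the earlier ones. -/
theorem eq_of_rank_eq {n : ℕ} {γ ξ : D.Path} (hv : (γ.1 n).src = (ξ.1 n).src)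
    (hr : rank n γ = rank n ξ) : ∀ i < n, γ.1 i = ξ.1 i := by
  induction n with
  | zero => intro i hi; omega
  | succ n ih =>
    rw [rank_succ, rank_succ] at hr
    have h1 := rank_lt_height n γ
    have h2 := rank_lt_height n ξ
    have he : γ.1 n = ξ.1 n := by
      rcases Edge.below_trichotomy (e := γ.1 n) (f := ξ.1 n) (by rw [γ.2, ξ.2, hv]) with h | h | h
      · have := Edge.offset_add_height_le h
        omega
      · exact h
      · have := Edge.offset_add_height_le h
        omega
    intro i hi
    rcases (Nat.lt_succ_iff.mp hi).eq_or_lt with rfl | hi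
    · exact he
    · exact ih (by rw [he]) (by rw [he] at hr; omega) i hi

theorem TailEq.eq_of_rank_eq {n : ℕ} {γ ξ : D.Path} (h : TailEq n γ ξ)
    (hr : rank n γ = rank n ξ) : γ = ξ := by
  refine Subtype.ext (funext fun i => ?_)
  rcases lt_or_ge i n with hi | hi
  exacts [Path.eq_of_rank_eq (by rw [h n le_rfl]) hr i hi, h i hi]

/-! ### Top paths and successors -/

/-- The first `n` edges of `γ` are the last among the finite paths to the same vertex. -/
def IsTop (n : ℕ) (γ : D.Path) : Prop :=
  rank n γ + 1 = D.height n (γ.1 n).src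

theorem rank_add_one_lt_of_not_isTop {n : ℕ} {γ : D.Path} (h : ¬ IsTop n γ) :
    rank n γ + 1 < D.height n (γ.1 n).src :=
  lt_of_le_of_ne (rank_lt_height n γ) h

theorem isTop_of_isTop_succ {n : ℕ} {γ : D.Path} (h : IsTop (n + 1) γ) :
    IsTop n γ ∧ ∀ f, ¬ (γ.1 n).Below f := by
  have h1 := rank_lt_height n γ
  have h2 := (γ.1 n).offset_add_height_le_height
  rw [IsTop, rank_succ, ← γ.2 n] at h
  exact ⟨by rw [IsTop]; omega, Edge.not_below_of_offset_add_height_eq (by omega)⟩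

/-- If the rank rose by more than one, the path with the same tail and the next rank would lie
strictly between. -/
theorem exists_rank_eq_of_isSucc {γ ξ : D.Path} (h : γ.IsSucc ξ) :
    ∃ n, TailEq n γ ξ ∧ rank n ξ = rank n γ + 1 := by
  obtain ⟨⟨j, hj, hj'⟩, hmin⟩ := h
  have ht : TailEq (j + 1) γ ξ := fun m hm => hj' m hm
  have hlt := ht.below_iff.mp ⟨j, hj, hj'⟩
  refine ⟨j + 1, ht, ?_⟩
  by_contra hne
  obtain ⟨ζ, hζ, hζr⟩ := exists_rank_eq (n := j + 1) (r := rank (j + 1) γ + 1) γ (by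
    have := rank_lt_height (j + 1) ξ
    rw [← ht _ le_rfl] at this
    omega)
  rcases hmin ζ (hζ.below_iff.mpr (by omega)) with rfl | h'
  · omega
  · have := rank_lt_of_below h' (ht.symm.trans hζ)
    omega

theorem exists_isSucc {n : ℕ} {γ : D.Path} (h : ¬ IsTop n γ) : ∃ ξ, γ.IsSucc ξ := by
  obtain ⟨ξ, ht, hr⟩ := exists_rank_eq γ (rank_add_one_lt_of_not_isTop h)
  refine ⟨ξ, ht.below_iff.mpr (by omega), fun ζ hζ => ?_⟩
  obtain ⟨j, hj, hj'⟩ := id hζ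
  have h1 : TailEq (max n (j + 1)) γ ζ := fun m hm => hj' m (by omega)
  have h2 := ht.mono (le_max_left n (j + 1))
  have h3 := rank_lt_of_below hζ h1
  have h4 := ht.rank_add_rank (le_max_left n (j + 1))
  rcases (h2.symm.trans h1).trichotomy with h | h | h
  · exact .inl h
  · exact .inr h
  · have := rank_lt_of_below h (h1.symm.trans h2)
    omega

section Successor

variable {γ ξ : D.Path} {m n : ℕ}

/-- The level `m` witnessing the succession is unrelated to `n`; both candidates for the next path
have equal rank at level `max n m`, hence coincide. -/
theorem rank_eq_of_not_isTop (h : TailEq m γ ξ) (hr : rank m ξ = rank m γ + 1)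
    (hn : ¬ IsTop n γ) : TailEq n γ ξ ∧ rank n ξ = rank n γ + 1 := by
  obtain ⟨ζ, ht, hζ⟩ := exists_rank_eq γ (rank_add_one_lt_of_not_isTop hn)
  have e1 := ht.rank_add_rank (le_max_left n m)
  have e2 := h.rank_add_rank (le_max_right n m)
  obtain rfl : ξ = ζ := TailEq.eq_of_rank_eq (n := max n m)
    ((h.symm.mono (le_max_right n m)).trans (ht.mono (le_max_left n m))) (by omega)
  exact ⟨ht, hζ⟩

theorem exists_level_of_isTop (h : TailEq m γ ξ) (hr : rank m ξ = rank m γ + 1)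
    (hn : IsTop n γ) : ∃ j, n ≤ j ∧ IsTop j γ ∧ rank j ξ = 0 ∧ (γ.1 j).Below (ξ.1 j) ∧
      (ξ.1 j).offset = (γ.1 j).offset + D.height j (γ.1 j).src := by
  classical
  have hm : ¬ IsTop m γ := fun h' => by
    have := rank_lt_height m ξ
    rw [← h m le_rfl, ← h', hr] at this
    omega
  -- Lower levels inherit `IsTop`, so `j` is the last top level: there the next edge is taken and
  -- everything before it is reset.
  obtain ⟨j, hnj, hj, hj'⟩ : ∃ j, n ≤ j ∧ IsTop j γ ∧ ¬ IsTop (j + 1) γ := by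
    by_contra! hcon
    have hall : ∀ i, n ≤ i → IsTop i γ := fun i hi => by
      induction i, hi using Nat.le_induction with
      | base => exact hn
      | succ i hi ih => exact hcon i hi ih
    rcases le_total n m with hle | hle
    · exact hm (hall m hle)
    · have := h.rank_add_rank hle
      have h2 := rank_lt_height n ξ
      rw [← h n hle, ← hn] at h2
      omega
  obtain ⟨ht, he⟩ := rank_eq_of_not_isTop h hr hj'
  rw [rank_succ, rank_succ] at he
  have h1 := rank_lt_height j ξ
  have h2 : rank j γ + 1 = D.height j (γ.1 j).src := hj
  refine ⟨j, hnj, hj, ?_⟩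
  rcases Edge.below_trichotomy (e := γ.1 j) (f := ξ.1 j)
    (by rw [γ.2, ξ.2, ht _ le_rfl]) with h' | h' | h'
  · have h3 := Edge.offset_add_height_le h'
    exact ⟨by omega, h', by omega⟩
  · rw [h'] at he h2
    omega
  · have h3 := Edge.offset_add_height_le h'
    omega

theorem src_le_succ (γ : D.Path) (h : n ≤ m) : ((γ.1 n).src : ℕ) ≤ (γ.1 m).src := by
  induction m, h using Nat.le_induction with
  | base => exact le_rfl
  | succ m hm ih =>
    have h1 := congrArg Fin.val (γ.2 m)
    rw [Edge.rng_val] at h1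
    omega

theorem src_eq_min_of_isTop (h : IsTop (n + 1) γ) :
    ((γ.1 n).src : ℕ) = min ((γ.1 (n + 1)).src : ℕ) (D.d * n) := by
  rw [← γ.2 n]
  exact Edge.src_eq_of_maximal (isTop_of_isTop_succ h).2

theorem src_eq_zero_of_isTop (h0 : 0 < n) (hnm : n ≤ m) (h : ((γ.1 n).src : ℕ) = 0)
    (hm : IsTop m γ) : ((γ.1 m).src : ℕ) = 0 := by
  induction m, hnm using Nat.le_induction with
  | base => exact h
  | succ m hle ih =>
    have h1 := ih (isTop_of_isTop_succ hm).1
    have h2 := src_eq_min_of_isTop hm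
    have h3 : 0 < D.d * m := Nat.mul_pos D.d_pos (h0.trans_le hle)
    omega

theorem src_succ_le_one (h : TailEq m γ ξ) (hr : rank m ξ = rank m γ + 1) (hn : 0 < n)
    (h0 : ((γ.1 n).src : ℕ) = 0) : ((ξ.1 n).src : ℕ) ≤ 1 := by
  by_cases htop : IsTop n γ
  · obtain ⟨j, hj, hjt, -, hb, ho⟩ := exists_level_of_isTop h hr htop
    refine (src_le_succ ξ hj).trans ?_
    have hj0 := src_eq_zero_of_isTop hn hj h0 hjt
    by_contra hlt
    have h1 : ((γ.1 j).src : ℕ) + (γ.1 j).shift = (ξ.1 j).src + (ξ.1 j).shift :=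
      congrArg Fin.val hb.1
    have h2 := (γ.1 j).shift.isLt
    have h3 : 0 < D.d * j := Nat.mul_pos D.d_pos (hn.trans_le hj)
    have h4 := (ξ.1 j).rng_val
    -- If the new source were at least 2, the edge `g` from vertex 1 would fit between two edges
    -- with consecutive offset intervals.
    obtain ⟨g, hg, hg'⟩ := Edge.exists_src_rng (n := j) (s := 1) h3 (v := (ξ.1 j).rng)
      (by omega) (by omega)
    have h5 := Edge.offset_add_height_le (e := γ.1 j) (f := g) ⟨hb.1.trans hg'.symm, .inl (by omega)⟩
    have h6 := Edge.offset_add_height_le (e := g) (f := ξ.1 j) ⟨hg', .inl (by omega)⟩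
    have h7 := D.height_pos j g.src
    omega
  · rw [← (rank_eq_of_not_isTop h hr htop).1 n le_rfl]
    omega

end Successor

theorem eq_maxPath_of_isTop {γ : D.Path} (h : ∀ n, IsTop n γ) : ∃ k, γ = D.maxPath k := by
  -- All edges being maximal, the path follows the right side until it reaches its final vertex
  -- index, or forever; the latter gives `k = ⊤`.
  have hmin : ∀ n m, n ≤ m → ((γ.1 n).src : ℕ) = min ((γ.1 m).src : ℕ) (D.d * n) := by
    intro n m hnm
    induction m, hnm using Nat.le_induction with
    | base => have := (γ.1 n).src.isLt; omega
    | succ m hm ih =>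
      have h1 := src_eq_min_of_isTop (h (m + 1))
      have h2 : D.d * n ≤ D.d * m := Nat.mul_le_mul_left _ hm
      omega
  obtain ⟨k, hk⟩ : ∃ k : ℕ∞, ∀ n, ((γ.1 n).src : ℕ) = D.cut k n := by
    by_cases hall : ∀ n, ((γ.1 n).src : ℕ) = D.d * n
    · exact ⟨⊤, fun n => by simp [cut, hall n]⟩
    · push Not at hall
      obtain ⟨N, hN⟩ := hall
      have hN' := (γ.1 N).src.isLt
      refine ⟨((γ.1 N).src : ℕ), fun n => ?_⟩
      simp only [cut, ENat.natCast_ne_top, if_false, ENat.toNat_natCast]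
      rcases le_total n N with hn | hn
      · exact hmin n N hn
      · have h1 := hmin N n hn
        have h2 := (γ.1 n).src.isLt
        omega
  refine ⟨k, Subtype.ext (funext fun n => ?_)⟩
  have hs : (γ.1 n).src = ((D.maxPath k).1 n).src := Fin.ext (hk n)
  have ht : (γ.1 n).shift = ((D.maxPath k).1 n).shift := by
    have h1 := congrArg Fin.val (γ.2 n)
    have h2 := hk n
    have h3 := hk (n + 1)
    rw [Edge.rng_val] at h1
    apply Fin.ext
    simp only [maxPath]
    omega
  refine Edge.ext_val (congrArg _ hs) (congrArg _ ht) ?_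
  rw [Edge.idx_eq_of_maximal (isTop_of_isTop_succ (h (n + 1))).2, hs, ht]
  rfl

theorem rank_minPath (k : ℕ∞) (n : ℕ) : rank n (D.minPath k) = 0 := by
  classical
  refine Finset.sum_eq_zero fun i _ => Finset.sum_eq_zero fun f hf => ?_
  simp only [Finset.mem_filter, Finset.mem_univ, true_and] at hf
  exfalso
  obtain ⟨h1, h2⟩ := hf
  replace h1 := congrArg Fin.val h1
  rw [Edge.rng_val, Edge.rng_val] at h1
  have h3 := f.shift.isLt
  have h5 := D.cut_le k i
  simp only [minPath] at h1 h2
  rcases h2 with h2 | h2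
  -- An edge with a source further left presupposes that the path has left the left side; there its
  -- shift is already the maximal `d`, so no such edge reaches the same vertex.
  · have h4 : D.cut k (i + 1) - D.cut k i = 0 := by
      have hne : k ≠ ⊤ := by
        rintro rfl
        simp [cut] at h2
      simp only [cut, hne, if_false, Nat.mul_add] at h2 ⊢
      omega
    omega
  · omega

/-! ### The transformation in terms of vertex and rank -/

theorem vershik_spec (γ : D.Path) :
    (∃ n, TailEq n γ (D.vershik γ) ∧ rank n (D.vershik γ) = rank n γ + 1) ∨
      ((∀ n, IsTop n γ) ∧ ∃ k, γ = D.maxPath k ∧ D.vershik γ = D.minPath (swapIndex k)) := by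
  by_cases h : ∃ ξ, γ.IsSucc ξ
  · left
    rw [vershik, dif_pos h]
    exact exists_rank_eq_of_isSucc h.choose_spec
  · right
    have htop : ∀ n, IsTop n γ := fun n => by_contra fun hn => h (exists_isSucc hn)
    have hk := eq_maxPath_of_isTop htop
    refine ⟨htop, hk.choose, hk.choose_spec, ?_⟩
    rw [vershik, dif_neg h, dif_pos hk]

section Vershik

variable {n : ℕ} {γ : D.Path}

theorem vershik_of_not_isTop (h : ¬ IsTop n γ) :
    ((D.vershik γ).1 n).src = (γ.1 n).src ∧ rank n (D.vershik γ) = rank n γ + 1 := by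
  rcases vershik_spec γ with ⟨m, hm, hr⟩ | ⟨h', -⟩
  · obtain ⟨h1, h2⟩ := rank_eq_of_not_isTop hm hr h
    exact ⟨by rw [h1 n le_rfl], h2⟩
  · exact absurd (h' n) h

theorem rank_vershik_of_isTop (h : IsTop n γ) : rank n (D.vershik γ) = 0 := by
  rcases vershik_spec γ with ⟨m, hm, hr⟩ | ⟨-, k, -, hk⟩
  · obtain ⟨j, hj, -, h0, -⟩ := exists_level_of_isTop hm hr h
    exact Nat.le_zero.mp ((rank_mono hj _).trans_eq h0)
  · rw [hk, rank_minPath]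

theorem src_vershik_le_one (hn : 0 < n) (h : ((γ.1 n).src : ℕ) = 0) :
    (((D.vershik γ).1 n).src : ℕ) ≤ 1 := by
  rcases vershik_spec γ with ⟨m, hm, hr⟩ | ⟨-, k, hk, hk'⟩
  · exact src_succ_le_one hm hr hn h
  · have h1 : D.cut k n = 0 := by rw [hk] at h; exact h
    have h2 : 0 < D.d * n := Nat.mul_pos D.d_pos hn
    -- Among the exceptional paths only `k = 0` stays on the left side, and its image, with index
    -- `⊤`, stays there as well.
    have hk0 : k = 0 := by
      rcases eq_or_ne k ⊤ with rfl | hne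
      · simp only [cut, if_true] at h1; omega
      · lift k to ℕ using hne
        simp only [cut, ENat.natCast_ne_top, if_false, ENat.toNat_natCast] at h1
        rw [show k = 0 by omega]; rfl
    rw [hk', hk0]
    simp [minPath, swapIndex, cut]

end Vershik

/-! ### Sets depending on finitely many edges, and vertex changes -/

/-- Membership in `B` depends only on the first `n` edges. -/
def Determined (n : ℕ) (B : Set D.Path) : Prop :=
  ∀ γ ξ : D.Path, (∀ i < n, γ.1 i = ξ.1 i) → (γ ∈ B ↔ ξ ∈ B)

theorem Determined.mono {n m : ℕ} {B : Set D.Path} (h : Determined n B) (hnm : n ≤ m) :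
    Determined m B :=
  fun γ ξ hγ => h γ ξ fun i hi => hγ i (hi.trans_le hnm)

/-- The first `n` edges of a path. -/
def initial (n : ℕ) (γ : D.Path) : (i : Fin n) → D.Edge i :=
  fun i => γ.1 i

theorem initial_eq_iff {n : ℕ} {γ ξ : D.Path} :
    initial n γ = initial n ξ ↔ ∀ i < n, γ.1 i = ξ.1 i :=
  ⟨fun h i hi => congrFun h ⟨i, hi⟩, fun h => funext fun i => h i i.2⟩

theorem measurable_val : Measurable fun γ : D.Path => γ.1 := measurable_subtype_coe

theorem Determined.measurableSet {n : ℕ} {B : Set D.Path} (h : Determined n B) :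
    MeasurableSet B := by
  have : B = ⋃ p ∈ initial n '' B, ⋂ i : Fin n, {γ | γ.1 i = p i} := by
    ext γ
    simp only [Set.mem_iUnion, Set.mem_iInter, Set.mem_ofPred_eq, exists_prop]
    constructor
    · exact fun hγ => ⟨_, ⟨γ, hγ, rfl⟩, fun _ => rfl⟩
    · rintro ⟨_, ⟨ξ, hξ, rfl⟩, hp⟩
      exact (h γ ξ fun i hi => hp ⟨i, hi⟩).mpr hξ
  rw [this]
  refine MeasurableSet.biUnion (Set.to_countable _) fun p _ => MeasurableSet.iInter fun i => ?_
  exact (measurable_pi_apply (i : ℕ)).comp measurable_val (MeasurableSet.singleton (p i))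

theorem isSetAlgebra_determined : IsSetAlgebra {B : Set D.Path | ∃ n, Determined n B} where
  empty_mem := ⟨0, fun _ _ _ => Iff.rfl⟩
  compl_mem := fun _ ⟨n, hn⟩ => ⟨n, fun γ ξ h => not_congr (hn γ ξ h)⟩
  union_mem := fun _ _ ⟨n, hn⟩ ⟨m, hm⟩ => ⟨max n m, fun γ ξ h =>
    or_congr (hn.mono (le_max_left n m) γ ξ h) (hm.mono (le_max_right n m) γ ξ h)⟩

theorem generateFrom_determined : (inferInstance : MeasurableSpace D.Path) =
    MeasurableSpace.generateFrom {B : Set D.Path | ∃ n, Determined n B} := by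
  refine le_antisymm ?_ (MeasurableSpace.generateFrom_le fun B ⟨_, h⟩ => h.measurableSet)
  refine Measurable.comap_le (f := fun γ : D.Path => γ.1) ?_
  refine @measurable_pi_lambda _ _ _ (MeasurableSpace.generateFrom _) _ _ fun n => ?_
  intro s _
  exact MeasurableSpace.measurableSet_generateFrom
    ⟨n + 1, fun γ ξ h => by simp only [Set.mem_preimage, h n (Nat.lt_succ_self n)]⟩

theorem rank_congr {n : ℕ} {γ ξ : D.Path} (h : ∀ i < n, γ.1 i = ξ.1 i) : rank n γ = rank n ξ :=
  Finset.sum_congr rfl fun i hi => by rw [h i (Finset.mem_range.mp hi)]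

theorem src_congr {n : ℕ} {γ ξ : D.Path} (h : ∀ i < n, γ.1 i = ξ.1 i) :
    (γ.1 n).src = (ξ.1 n).src := by
  cases n with
  | zero => exact Fin.ext (by have := (γ.1 0).src.isLt; have := (ξ.1 0).src.isLt; omega)
  | succ n => rw [← γ.2, ← ξ.2, h n (Nat.lt_succ_self n)]

theorem determined_of_src_rank {n : ℕ} (p : Fin (D.d * n + 1) → ℕ → Prop) :
    Determined n {γ : D.Path | p (γ.1 n).src (rank n γ)} := fun γ ξ h => by
  simp only [Set.mem_ofPred_eq, rank_congr h, src_congr h]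

theorem isTop_congr {n : ℕ} {γ ξ : D.Path} (h : ∀ i < n, γ.1 i = ξ.1 i) :
    IsTop n γ ↔ IsTop n ξ := by
  rw [IsTop, IsTop, rank_congr h, src_congr h]

open Classical in
/-- The level `n` vertex of `T γ`, recorded only if it differs from that of `γ`. -/
noncomputable def vertexChange (n : ℕ) (γ : D.Path) : Option (Fin (D.d * n + 1)) :=
  if ((D.vershik γ).1 n).src = (γ.1 n).src then none else some ((D.vershik γ).1 n).src

/-- The rank after one step is a function of the first `n` edges, being 0 or one more; the vertex is
recovered from `vertexChange`, and the two together determine the new edges. -/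
theorem initial_vershik_congr {n : ℕ} {γ ξ : D.Path} (h : ∀ i < n, γ.1 i = ξ.1 i)
    (hc : vertexChange n γ = vertexChange n ξ) :
    ∀ i < n, (D.vershik γ).1 i = (D.vershik ξ).1 i := by
  have hs := src_congr h
  refine eq_of_rank_eq ?_ ?_
  · unfold vertexChange at hc
    split_ifs at hc with h1 h2
    · rw [h1, h2, hs]
    · exact Option.some.inj hc
  · by_cases ht : IsTop n γ
    · rw [rank_vershik_of_isTop ht, rank_vershik_of_isTop ((isTop_congr h).mp ht)]
    · rw [(vershik_of_not_isTop ht).2, (vershik_of_not_isTop (mt (isTop_congr h).mpr ht)).2,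
        rank_congr h]

theorem measurableSet_vertexChange (hT : Measurable D.vershik) (n : ℕ)
    (o : Option (Fin (D.d * n + 1))) : MeasurableSet (vertexChange (D := D) n ⁻¹' {o}) := by
  have h1 : ∀ v, MeasurableSet {γ : D.Path | (γ.1 n).src = v} := fun v =>
    (determined_of_src_rank (n := n) fun w _ => w = v).measurableSet
  have h2 : ∀ v, MeasurableSet {γ : D.Path | ((D.vershik γ).1 n).src = v} := fun v => hT (h1 v)
  cases o with
  | none =>
    convert MeasurableSet.iUnion fun v => (h1 v).inter (h2 v) using 1
    ext γ
    simp [vertexChange, eq_comm]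
  | some v =>
    convert (h2 v).diff (h1 v) using 1
    ext γ
    simp only [vertexChange, Set.mem_preimage, Set.mem_singleton_iff, Set.mem_sdiff,
      Set.mem_ofPred_eq]
    split_ifs with h
    · simp only [h, false_iff]; tauto
    · simp only [Option.some.injEq]
      constructor
      · rintro rfl; exact ⟨rfl, fun h' => h h'.symm⟩
      · exact fun h' => h'.1

/-! ### Vertex changes are rare -/

/-- The paths whose level `n` vertex is off the two sides of the diagram and whose first `n` edges
have rank `j`. -/
def inner (D : LimitedScopeDiagram) (n j : ℕ) : Set D.Path :=
  {γ | (0 < ((γ.1 n).src : ℕ) ∧ ((γ.1 n).src : ℕ) < D.d * n) ∧ rank n γ = j}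

theorem measurableSet_inner (n j : ℕ) : MeasurableSet (inner D n j) :=
  (determined_of_src_rank (n := n) fun v r =>
    (0 < (v : ℕ) ∧ (v : ℕ) < D.d * n) ∧ r = j).measurableSet

theorem preimage_inner_succ {n j : ℕ} (hj : j + 1 < n) :
    D.vershik ⁻¹' inner D n (j + 1) = inner D n j := by
  ext γ
  simp only [inner, Set.mem_preimage, Set.mem_ofPred_eq]
  constructor
  · rintro ⟨h1, h2⟩
    have ht : ¬ IsTop n γ := fun h => by rw [rank_vershik_of_isTop h] at h2; omega
    obtain ⟨h3, h4⟩ := vershik_of_not_isTop ht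
    rw [h3] at h1
    exact ⟨h1, by omega⟩
  · rintro ⟨h1, h2⟩
    have hh := le_height h1.1 h1.2
    have ht : ¬ IsTop n γ := fun h => by rw [IsTop] at h; omega
    obtain ⟨h3, h4⟩ := vershik_of_not_isTop ht
    rw [h3]
    exact ⟨h1, by omega⟩

variable {μ : Measure D.Path} [IsProbabilityMeasure μ]

/-- The floors of rank `0, …, n - 1` are disjoint and, by invariance, of equal measure. -/
theorem measureReal_inner_zero_le (hμ : MeasurePreserving D.vershik μ μ) {n : ℕ} (hn : 0 < n) :
    μ.real (inner D n 0) ≤ 1 / n := by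
  have heq : ∀ j, j < n → μ.real (inner D n j) = μ.real (inner D n 0) := fun j hj => by
    induction j with
    | zero => rfl
    | succ j ih =>
      rw [← ih (by omega), ← preimage_inner_succ hj,
        hμ.measureReal_preimage (measurableSet_inner n _).nullMeasurableSet]
  have hdisj : Set.PairwiseDisjoint (↑(Finset.range n)) (inner D n) := fun i _ j _ hij =>
    Set.disjoint_left.mpr fun γ h1 h2 => hij (h1.2.symm.trans h2.2)
  have hsum := measureReal_biUnion_finset (μ := μ) hdisj fun j _ => measurableSet_inner n j
  rw [Finset.sum_congr rfl fun j hj => heq j (Finset.mem_range.mp hj), Finset.sum_const,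
    Finset.card_range, nsmul_eq_mul] at hsum
  have hle : μ.real (⋃ b ∈ Finset.range n, inner D n b) ≤ 1 := measureReal_le_one
  rw [le_div_iff₀ (by exact_mod_cast hn)]
  linarith

theorem isTop_of_src_vershik_ne {n : ℕ} {γ : D.Path}
    (h : ((D.vershik γ).1 n).src ≠ (γ.1 n).src) : IsTop n γ :=
  by_contra fun ht => h (vershik_of_not_isTop ht).1

theorem measureReal_vertexChange_le (hμ : MeasurePreserving D.vershik μ μ) {n : ℕ} (hn : 2 ≤ n) :
    μ.real {γ | vertexChange n γ ≠ none} ≤ 3 / n := by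
  set I : Set D.Path := {γ | 0 < ((γ.1 n).src : ℕ) ∧ ((γ.1 n).src : ℕ) < D.d * n} with hI
  set Z : Set D.Path := {γ | ((γ.1 n).src : ℕ) = 0} with hZ
  have mI : MeasurableSet I := (determined_of_src_rank (n := n) fun v _ =>
    0 < (v : ℕ) ∧ (v : ℕ) < D.d * n).measurableSet
  have mZ : MeasurableSet Z := (determined_of_src_rank (n := n) fun v _ =>
    (v : ℕ) = 0).measurableSet
  have hdn : n ≤ D.d * n := Nat.le_mul_of_pos_left _ D.d_pos
  have hb : μ.real (D.vershik ⁻¹' inner D n 0) ≤ 1 / n := by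
    rw [hμ.measureReal_preimage (measurableSet_inner n 0).nullMeasurableSet]
    exact measureReal_inner_zero_le hμ (by omega)
  have henter : μ.real (D.vershik ⁻¹' I \ I) ≤ 1 / n := by
    refine (measureReal_mono fun γ hγ => ?_).trans hb
    refine ⟨hγ.1, rank_vershik_of_isTop (isTop_of_src_vershik_ne fun h => hγ.2 ?_)⟩
    have h1 := hγ.1
    simp only [hI, Set.mem_preimage, Set.mem_ofPred_eq, h] at h1
    exact h1
  have hexit : μ.real (I \ D.vershik ⁻¹' I) ≤ 1 / n := by
    rwa [measureReal_exit_eq_enter hμ mI]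
  have hzero : μ.real (D.vershik ⁻¹' Z \ Z) ≤ 1 / n := by
    rw [← measureReal_exit_eq_enter hμ mZ]
    refine (measureReal_mono fun γ hγ => ?_).trans hb
    obtain ⟨h0, h1⟩ := hγ
    simp only [hZ, Set.mem_preimage, Set.mem_ofPred_eq] at h0 h1
    -- A departure from the left side lands exactly at vertex 1, which is interior because `2 ≤ D.d
    -- * n`.
    have h2 := src_vershik_le_one (by omega) h0
    exact ⟨⟨by omega, by omega⟩, rank_vershik_of_isTop (isTop_of_src_vershik_ne fun h => by
      rw [h] at h1; exact h1 h0)⟩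
  -- A change arrives in the interior, leaves it, or joins the two sides; `h3` excludes the jump
  -- from left to right.
  have hsub : {γ : D.Path | vertexChange n γ ≠ none} ⊆
      (D.vershik ⁻¹' inner D n 0 ∪ I \ D.vershik ⁻¹' I) ∪ (D.vershik ⁻¹' Z \ Z) := by
    intro γ hγ
    have hne : (((D.vershik γ).1 n).src : ℕ) ≠ (γ.1 n).src := by
      intro h
      exact hγ (if_pos (Fin.ext h))
    have h1 := (γ.1 n).src.isLt
    have h2 := ((D.vershik γ).1 n).src.isLt
    have h3 := src_vershik_le_one (γ := γ) (n := n) (by omega)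
    have h4 : rank n (D.vershik γ) = 0 :=
      rank_vershik_of_isTop (isTop_of_src_vershik_ne fun h => hne (congrArg Fin.val h))
    simp only [hI, hZ, inner, h4, and_true, Set.mem_union, Set.mem_sdiff, Set.mem_preimage,
      Set.mem_ofPred_eq]
    omega
  have h1 := (measureReal_mono (μ := μ) hsub).trans (measureReal_union_le _ _)
  have h2 := measureReal_union_le (μ := μ) (D.vershik ⁻¹' inner D n 0) (I \ D.vershik ⁻¹' I)
  have h3 : (3 : ℝ) / n = 1 / n + 1 / n + 1 / n := by ring
  linarith

theorem fiberEntropy_vertexChange_le (hμ : MeasurePreserving D.vershik μ μ) {n : ℕ} (hn : 2 ≤ n) :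
    fiberEntropy μ (vertexChange (D := D) n) ≤
      -Real.log (1 - 1 / n) + 3 / n * Real.log ((D.d * n + 1 : ℕ) / (1 / n)) := by
  have hn' : (2 : ℝ) ≤ n := by exact_mod_cast hn
  -- With `δ = 1 / n` the first term vanishes in the limit, while the logarithm in the second grows
  -- only like `log n`.
  refine fiberEntropy_option_le (Nat.succ_pos _) (measurableSet_vertexChange hμ.measurable n)
    (measureReal_vertexChange_le hμ hn) (by positivity) ?_
  rw [div_lt_one (by linarith)]
  linarith

theorem tendsto_fiberEntropy_vertexChange (hμ : MeasurePreserving D.vershik μ μ) :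
    Filter.Tendsto (fun n => fiberEntropy μ (vertexChange (D := D) n)) Filter.atTop (nhds 0) := by
  have hinv := tendsto_one_div_atTop_nhds_zero_nat (𝕜 := ℝ)
  have h1 : Filter.Tendsto (fun n : ℕ => -Real.log (1 - 1 / n)) Filter.atTop (nhds 0) := by
    have : ContinuousAt (fun x : ℝ => -Real.log (1 - x)) 0 :=
      (ContinuousAt.log (by fun_prop) (by norm_num)).neg
    simpa [Function.comp_def] using this.tendsto.comp hinv
  have h2 : Filter.Tendsto (fun n : ℕ => Real.log n / n) Filter.atTop (nhds 0) := by
    have := (Real.isLittleO_log_id_atTop.tendsto_div_nhds_zero).comp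
      (tendsto_natCast_atTop_atTop (R := ℝ))
    exact this
  have h3 : Filter.Tendsto (fun n : ℕ => -Real.log (1 - 1 / (n : ℝ)) +
      (3 * Real.log (D.d + 1 : ℕ) * (1 / n) + 6 * (Real.log n / n))) Filter.atTop (nhds 0) := by
    simpa using h1.add ((hinv.const_mul (3 * Real.log (D.d + 1 : ℕ))).add (h2.const_mul 6))
  refine squeeze_zero' (.of_forall fun n => fiberEntropy_nonneg _) ?_ h3
  filter_upwards [Filter.eventually_ge_atTop 2] with n hn
  refine (fiberEntropy_vertexChange_le hμ hn).trans ?_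
  have hn0 : (0 : ℝ) < n := by exact_mod_cast (by omega : 0 < n)
  have hle : ((D.d * n + 1 : ℕ) : ℝ) / (1 / n) ≤ (D.d + 1 : ℕ) * (n : ℝ) * n := by
    rw [div_div_eq_mul_div, div_one]
    refine mul_le_mul_of_nonneg_right ?_ hn0.le
    have : D.d * n + 1 ≤ (D.d + 1) * n := by rw [Nat.add_mul]; omega
    exact_mod_cast this
  have hlog := Real.log_le_log (by positivity) hle
  rw [Real.log_mul (by positivity) hn0.ne', Real.log_mul (by positivity) hn0.ne'] at hlog
  have hmul := mul_le_mul_of_nonneg_left hlog (by positivity : (0 : ℝ) ≤ 3 / n)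
  have e : 3 / (n : ℝ) * (Real.log (D.d + 1 : ℕ) + Real.log n + Real.log n) =
      3 * Real.log (D.d + 1 : ℕ) * (1 / n) + 6 * (Real.log n / n) := by ring
  linarith

/-! ### Approximation and conclusion -/

/-- Every finite measurable partition is, up to a discrepancy of small entropy, determined by
finitely many edges. -/
theorem exists_determined_discrepancy_lt {k : ℕ} {P : D.Path → Fin k} (hP : Measurable P) {η : ℝ}
    (hη : 0 < η) : ∃ (n : ℕ) (B : Fin k → Set D.Path), (∀ i, Determined n (B i)) ∧
      fiberEntropy μ (discrepancy P B) ≤ η := by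
  obtain ⟨x₀⟩ : Nonempty D.Path := nonempty_of_isProbabilityMeasure μ
  have hk : 0 < k := (Nat.zero_le _).trans_lt (P x₀).isLt
  have hk' : (1 : ℝ) ≤ k := by exact_mod_cast hk
  obtain ⟨δ, hδ, hδ1, hδη⟩ : ∃ δ : ℝ, 0 < δ ∧ δ < 1 ∧ -Real.log (1 - δ) ≤ η / 2 := by
    -- This `δ` makes the first term of `fiberEntropy_option_le` equal to `η / 2`; `ε` below is
    -- chosen so that the second is `η / 2` as well.
    refine ⟨1 - Real.exp (-(η / 2)), ?_, ?_, by simp⟩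
    · have := Real.exp_lt_one_iff.mpr (show -(η / 2) < 0 by linarith)
      linarith
    · have := Real.exp_pos (-(η / 2))
      linarith
  have hlog : 0 < Real.log (k / δ) := Real.log_pos (by rw [lt_div_iff₀ hδ]; linarith)
  set ε : ℝ := η / 2 / Real.log (k / δ) / k with hε
  have hε0 : 0 < ε := by positivity
  have hdense := Measure.MeasureDense.of_generateFrom_isSetAlgebra_finite (μ := μ)
    (isSetAlgebra_determined (D := D)) generateFrom_determined
  have happ : ∀ i, ∃ B : Set D.Path, (∃ n, Determined n B) ∧
      μ (symmDiff (P ⁻¹' {i}) B) < ENNReal.ofReal ε := fun i =>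
    hdense.approx _ (hP (MeasurableSet.singleton i)) (measure_ne_top _ _) ε hε0
  choose B hB hBε using happ
  choose N hN using hB
  refine ⟨Finset.univ.sup N, B, fun i => (hN i).mono (Finset.le_sup (Finset.mem_univ i)), ?_⟩
  have hmeas : μ.real {x | discrepancy P B x ≠ none} ≤ k * ε := by
    have hsub : {x | discrepancy P B x ≠ none} ⊆ ⋃ i, symmDiff (P ⁻¹' {i}) (B i) := by
      intro x hx
      have : ¬ ∀ i, P x = i ↔ x ∈ B i := fun h => hx (if_pos h)
      push Not at this
      obtain ⟨i, hi⟩ := this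
      refine Set.mem_iUnion.mpr ⟨i, ?_⟩
      rw [Set.mem_symmDiff]
      simpa [and_comm] using hi
    refine (measureReal_mono hsub).trans ((measureReal_iUnion_fintype_le _).trans ?_)
    refine (Finset.sum_le_sum fun i _ => ?_).trans_eq (by simp : ∑ _i : Fin k, ε = k * ε)
    exact ENNReal.toReal_le_of_le_ofReal hε0.le (hBε i).le
  refine (fiberEntropy_option_le hk (measurableSet_discrepancy hP fun i => (hN i).measurableSet)
    hmeas hδ hδ1).trans ?_
  have : k * ε * Real.log (k / δ) = η / 2 := by
    rw [hε]; field_simp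
  linarith

/-- The initial edges and the successive vertex changes determine the first `n` edges along the
orbit, hence membership in each `B i`; the discrepancies then restore `P`. Subadditivity and
invariance give the bound. -/
theorem joinEntropy_le (hμ : MeasurePreserving D.vershik μ μ) {k : ℕ} {P : D.Path → Fin k}
    (hP : Measurable P) {n : ℕ} {B : Fin k → Set D.Path} (hB : ∀ i, Determined n (B i)) (N : ℕ) :
    joinEntropy μ D.vershik P N ≤ fiberEntropy μ (initial (D := D) n) +
      N * (fiberEntropy μ (vertexChange (D := D) n) + fiberEntropy μ (discrepancy P B)) := by
  have m1 : ∀ p, MeasurableSet (initial (D := D) n ⁻¹' {p}) := fun p =>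
    Determined.measurableSet (n := n) fun γ ξ h => by
      simp only [Set.mem_preimage, initial_eq_iff.mpr h]
  have m2 := measurableSet_vertexChange hμ.measurable n
  have m3 := measurableSet_discrepancy hP fun i => (hB i).measurableSet
  have w2 := measurableSet_fiber_pi (Y := fun (i : Fin N) x => vertexChange n (D.vershik^[i] x))
    fun i o => (hμ.iterate i).measurable (m2 o)
  have w3 := measurableSet_fiber_pi (Y := fun (i : Fin N) x => discrepancy P B (D.vershik^[i] x))
    fun i o => (hμ.iterate i).measurable (m3 o)
  rw [joinEntropy_eq_fiberEntropy]
  have hle := fiberEntropy_le_of_factor (μ := μ)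
    (X := fun x (i : Fin N) => P (D.vershik^[i] x))
    (measurableSet_fiber_pair (measurableSet_fiber_pair m1 w2) w3) fun x y h => by
      obtain ⟨h12, h3⟩ := Prod.ext_iff.mp h
      obtain ⟨h1, h2⟩ := Prod.ext_iff.mp h12
      have key : ∀ i ≤ N, ∀ j < n, (D.vershik^[i] x).1 j = (D.vershik^[i] y).1 j := fun i hi => by
        induction i with
        | zero => exact initial_eq_iff.mp h1
        | succ i ih =>
          rw [Function.iterate_succ_apply', Function.iterate_succ_apply']
          exact initial_vershik_congr (ih (by omega)) (congrFun h2 ⟨i, hi⟩)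
      funext i
      exact eq_of_discrepancy_eq (congrFun h3 i) fun j => hB j _ _ (key i i.2.le)
  have h4 := fiberEntropy_pair_le (μ := μ) (measurableSet_fiber_pair m1 w2) w3
  have h5 := fiberEntropy_pair_le (μ := μ) m1 w2
  have h6 := fiberEntropy_word_le hμ m2 N
  have h7 := fiberEntropy_word_le hμ m3 N
  refine hle.trans (h4.trans ?_)
  rw [mul_add, ← add_assoc]
  exact add_le_add (h5.trans (add_le_add le_rfl h6)) h7

theorem partitionEntropy_eq_zero (hμ : MeasurePreserving D.vershik μ μ) {k : ℕ}
    {P : D.Path → Fin k} (hP : Measurable P) : partitionEntropy μ D.vershik P = 0 := by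
  have key : ∀ η : ℝ, 0 < η → partitionEntropy μ D.vershik P ≤ ENNReal.ofReal η := fun η hη => by
    -- The sets `B` are fixed first: raising the level from `m` to `n` leaves the discrepancy
    -- unchanged while the entropy of the vertex change tends to 0.
    obtain ⟨m, B, hB, hBη⟩ := exists_determined_discrepancy_lt (μ := μ) hP (half_pos hη)
    obtain ⟨n, hn, hmn⟩ := (((tendsto_fiberEntropy_vertexChange hμ).eventually_lt_const
      (half_pos hη)).and (Filter.eventually_ge_atTop m)).exists
    refine (partitionEntropy_le_of_joinEntropy_le
      (joinEntropy_le hμ hP fun i => (hB i).mono hmn)).trans (ENNReal.ofReal_le_ofReal ?_)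
    linarith
  refine le_antisymm (ENNReal.le_of_forall_pos_le_add fun ε hε _ => ?_) zero_le
  simpa using key ε hε

end Path

end LimitedScopeDiagram

theorem mainTheorem10 (D : LimitedScopeDiagram) (μ : Measure D.Path) [IsProbabilityMeasure μ]
    (hμ : MeasurePreserving D.vershik μ μ) :
    measureEntropy μ D.vershik = 0 := by
  simp only [measureEntropy, ENNReal.iSup_eq_zero]
  exact fun k P hP => LimitedScopeDiagram.Path.partitionEntropy_eq_zero hμ hP
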